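/- Let $\mathcal H$ and $\mathcal K$ be complex Hilbert spaces and let $\Phi:\mathcal B(\mathcal H)\to\mathcal B(\mathcal K)$ be a unital positive linear map (for instance $\mathcal K=\mathcal H$). Let $A\in\mathcal B(\mathcal H)$ and let $m,M$ be real numbers with $m>0$ and $$m\mathbf 1_{\mathcal H}\le \mathbf 1_{\mathcal H}\le A\le M\mathbf 1_{\mathcal H},$$ where $X\le Y$ means that $Y-X$ is a positive operator. Real powers of positive invertible operators are taken in the sense of the continuous functional calculus. Then: 1. If $0\le p\le 1$, then $\Phi(A)^p\le \Phi(A^p)+p\left(m^{p-1}-M^{p-1}\right)\left(\Phi(A)-\mathbf 1_{\mathcal K}\right)$. 2. If $-1\le p\le 0$, then $\Phi(A)^p\ge \Phi(A^p)+p\left(m^{p-1}-M^{p-1}\right)\left(\Phi(A)-\mathbf 1_{\mathcal K}\right)$. 3. If $1\le p\le 2$, then $\Phi(A^p)\le \Phi(A)^p+p\left(M^{p-1}-m^{p-1}\right)\left(\Phi(A)-\mathbf 1_{\mathcal K}\right)$. -/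

import Mathlib

/-! By the mean value theorem, bounds on the derivative `p * s ^ (p - 1)` trap `t ^ p` between lines
through `(1, 1)`. The functional calculus carries these bounds to `A` and to `Φ A`. A unital `Φ`
commutes with affine functions, so `Φ (A ^ p)` and `Φ A ^ p` are both compared with multiples of `Φ
A - 1`; the difference of the slopes, taken at `m` and `M`, is the constant. -/

theorem Real.exists_rpow_sub_one_eq {t : ℝ} (ht : 1 ≤ t) (p : ℝ) :
    ∃ s ∈ Set.Icc 1 t, t ^ p - 1 = p * s ^ (p - 1) * (t - 1) := by
  rcases ht.eq_or_lt with rfl | ht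
  · exact ⟨1, by simp, by simp⟩
  obtain ⟨s, hs, h⟩ := exists_hasDerivAt_eq_slope (fun x : ℝ => x ^ p)
    (fun x => p * x ^ (p - 1)) ht
    (fun x hx => (Real.continuousAt_rpow_const x p
      (Or.inl (zero_lt_one.trans_le hx.1).ne')).continuousWithinAt)
    (fun x hx => Real.hasDerivAt_rpow_const (Or.inl (zero_lt_one.trans hx.1).ne'))
  refine ⟨s, ⟨hs.1.le, hs.2.le⟩, ?_⟩
  rw [h, Real.one_rpow, div_mul_cancel₀ _ (sub_pos.2 ht).ne']

theorem Real.rpow_le_affine_of_le {t c p : ℝ} (ht : 1 ≤ t)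
    (h : ∀ s ∈ Set.Icc 1 t, p * s ^ (p - 1) ≤ c) : t ^ p ≤ c * t + (1 - c) := by
  obtain ⟨s, hs, e⟩ := Real.exists_rpow_sub_one_eq ht p
  have := mul_le_mul_of_nonneg_right (h s hs) (sub_nonneg.2 ht)
  linarith

theorem Real.affine_le_rpow_of_le {t c p : ℝ} (ht : 1 ≤ t)
    (h : ∀ s ∈ Set.Icc 1 t, c ≤ p * s ^ (p - 1)) : c * t + (1 - c) ≤ t ^ p := by
  obtain ⟨s, hs, e⟩ := Real.exists_rpow_sub_one_eq ht p
  have := mul_le_mul_of_nonneg_right (h s hs) (sub_nonneg.2 ht)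
  linarith

section CStarAlgebra

theorem cfc_affine_eq {B : Type*} [CStarAlgebra B] {a : B} (ha : IsSelfAdjoint a) (c d : ℝ) :
    cfc (fun x : ℝ => c * x + d) a = c • a + d • (1 : B) := by
  rw [cfc_add (a := a) (fun x : ℝ => c * x) (fun _ => d), cfc_const_mul_id c a, cfc_const d a,
    Algebra.algebraMap_eq_smul_one]

theorem PositiveLinearMap.map_one_add_real_smul_sub_one {B C : Type*}
    [CStarAlgebra B] [PartialOrder B] [CStarAlgebra C] [PartialOrder C]
    (Φ : PositiveLinearMap ℂ B C) (hΦ : Φ 1 = 1) (a : B) (c : ℝ) : Φ (1 + c • (a - 1)) = 1 + c • (Φ a - 1) := by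
  rw [map_add, ← Complex.coe_smul c (a - 1), map_smul, map_sub, hΦ, Complex.coe_smul]

variable {B : Type*} [CStarAlgebra B] [PartialOrder B] [StarOrderedRing B]

theorem CFC.rpow_eq_cfc_real_of_one_le {a : B} (ha : 1 ≤ a) (p : ℝ) :
    a ^ p = cfc (fun x : ℝ => x ^ p) a :=
  CFC.rpow_eq_cfc_real (zero_le_one.trans ha)

theorem one_le_of_mem_spectrum {a : B} (ha : 1 ≤ a) {x : ℝ} (hx : x ∈ spectrum ℝ a) : 1 ≤ x :=
  (algebraMap_le_iff_le_spectrum (R := ℝ) (r := 1) (a := a)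
    (IsSelfAdjoint.of_nonneg (zero_le_one.trans ha))).1 (by simpa using ha) x hx

theorem le_of_mem_spectrum_of_le_smul_one {a : B} (ha : 1 ≤ a) {M : ℝ} (hM : a ≤ M • (1 : B))
    {x : ℝ} (hx : x ∈ spectrum ℝ a) : x ≤ M :=
  (le_algebraMap_iff_spectrum_le (R := ℝ) (r := M) (a := a)
    (IsSelfAdjoint.of_nonneg (zero_le_one.trans ha))).1
    (by simpa [Algebra.algebraMap_eq_smul_one] using hM) x hx

theorem continuousOn_rpow_spectrum {a : B} (ha : 1 ≤ a) (p : ℝ) :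
    ContinuousOn (fun x : ℝ => x ^ p) (spectrum ℝ a) := fun x hx =>
  (Real.continuousAt_rpow_const x p
    (Or.inl (zero_lt_one.trans_le (one_le_of_mem_spectrum ha hx)).ne')).continuousWithinAt

theorem CFC.rpow_le_of_one_le {a : B} (ha : 1 ≤ a) {p c : ℝ}
    (h : ∀ t ∈ spectrum ℝ a, ∀ s ∈ Set.Icc 1 t, p * s ^ (p - 1) ≤ c) :
    a ^ p ≤ 1 + c • (a - 1) := by
  have hsa : IsSelfAdjoint a := IsSelfAdjoint.of_nonneg (zero_le_one.trans ha)
  have key : a ^ p ≤ c • a + (1 - c) • (1 : B) := by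
    rw [CFC.rpow_eq_cfc_real_of_one_le ha, ← cfc_affine_eq hsa]
    exact cfc_mono (fun t ht => Real.rpow_le_affine_of_le (one_le_of_mem_spectrum ha ht) (h t ht))
      (continuousOn_rpow_spectrum ha p)
  convert key using 1
  module

theorem CFC.le_rpow_of_one_le {a : B} (ha : 1 ≤ a) {p c : ℝ}
    (h : ∀ t ∈ spectrum ℝ a, ∀ s ∈ Set.Icc 1 t, c ≤ p * s ^ (p - 1)) :
    1 + c • (a - 1) ≤ a ^ p := by
  have hsa : IsSelfAdjoint a := IsSelfAdjoint.of_nonneg (zero_le_one.trans ha)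
  have key : c • a + (1 - c) • (1 : B) ≤ a ^ p := by
    rw [CFC.rpow_eq_cfc_real_of_one_le ha, ← cfc_affine_eq hsa]
    exact cfc_mono (fun t ht => Real.affine_le_rpow_of_le (one_le_of_mem_spectrum ha ht) (h t ht))
      (by fun_prop) (continuousOn_rpow_spectrum ha p)
  convert key using 1
  module

variable {C : Type*} [CStarAlgebra C] [PartialOrder C] [StarOrderedRing C]

/-- The slope `c` serves `Φ a`, for which only the lower bound `1` is used; `d` serves `a` and may
depend on how far its spectrum reaches. -/
theorem PositiveLinearMap.rpow_map_le (Φ : PositiveLinearMap ℂ B C) (hΦ : Φ 1 = 1) {a : B}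
    (ha : 1 ≤ a) {p c d : ℝ}
    (hc : ∀ s, 1 ≤ s → p * s ^ (p - 1) ≤ c)
    (hd : ∀ t ∈ spectrum ℝ a, ∀ s ∈ Set.Icc 1 t, d ≤ p * s ^ (p - 1)) :
    Φ a ^ p ≤ Φ (a ^ p) + (c - d) • (Φ a - 1) := by
  have h1 : 1 ≤ Φ a := hΦ ▸ OrderHomClass.mono Φ ha
  have h2 := CFC.rpow_le_of_one_le h1 fun _ _ s hs => hc s hs.1
  have h3 := OrderHomClass.mono Φ (CFC.le_rpow_of_one_le ha hd)
  rw [Φ.map_one_add_real_smul_sub_one hΦ] at h3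
  calc Φ a ^ p ≤ 1 + c • (Φ a - 1) := h2
    _ = (1 + d • (Φ a - 1)) + (c - d) • (Φ a - 1) := by module
    _ ≤ _ := by gcongr

theorem PositiveLinearMap.map_rpow_le (Φ : PositiveLinearMap ℂ B C) (hΦ : Φ 1 = 1) {a : B}
    (ha : 1 ≤ a) {p c d : ℝ}
    (hc : ∀ s, 1 ≤ s → c ≤ p * s ^ (p - 1))
    (hd : ∀ t ∈ spectrum ℝ a, ∀ s ∈ Set.Icc 1 t, p * s ^ (p - 1) ≤ d) :
    Φ (a ^ p) ≤ Φ a ^ p + (d - c) • (Φ a - 1) := by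
  have h1 : 1 ≤ Φ a := hΦ ▸ OrderHomClass.mono Φ ha
  have h2 := CFC.le_rpow_of_one_le h1 fun _ _ s hs => hc s hs.1
  have h3 := OrderHomClass.mono Φ (CFC.rpow_le_of_one_le ha hd)
  rw [Φ.map_one_add_real_smul_sub_one hΦ] at h3
  calc Φ (a ^ p) ≤ 1 + d • (Φ a - 1) := h3
    _ = (1 + c • (Φ a - 1)) + (d - c) • (Φ a - 1) := by module
    _ ≤ _ := by gcongr

end CStarAlgebra

theorem mainTheorem4
    {H : Type*} [NormedAddCommGroup H] [InnerProductSpace ℂ H] [CompleteSpace H]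
    {K : Type*} [NormedAddCommGroup K] [InnerProductSpace ℂ K] [CompleteSpace K]
    (Φ : PositiveLinearMap ℂ (H →L[ℂ] H) (K →L[ℂ] K)) (hΦ : Φ 1 = 1)
    (A : H →L[ℂ] H) (m M : ℝ) (hm : 0 < m)
    (hm1 : m • (1 : H →L[ℂ] H) ≤ 1) (h1A : 1 ≤ A) (hAM : A ≤ M • (1 : H →L[ℂ] H)) :
    (∀ p : ℝ, 0 ≤ p → p ≤ 1 →
      Φ A ^ p ≤ Φ (A ^ p) + (p * (m ^ (p - 1) - M ^ (p - 1))) • (Φ A - 1)) ∧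
    (∀ p : ℝ, -1 ≤ p → p ≤ 0 →
      Φ A ^ p ≥ Φ (A ^ p) + (p * (m ^ (p - 1) - M ^ (p - 1))) • (Φ A - 1)) ∧
    (∀ p : ℝ, 1 ≤ p → p ≤ 2 →
      Φ (A ^ p) ≤ Φ A ^ p + (p * (M ^ (p - 1) - m ^ (p - 1))) • (Φ A - 1)) := by
  -- If `H` is zero, `hm1` does not force `m ≤ 1`; but then `Φ 1 = 1` makes `K` zero too.
  rcases subsingleton_or_nontrivial (H →L[ℂ] H) with hH | hH
  · have h10 : (1 : K →L[ℂ] K) = 0 := by rw [← hΦ, Subsingleton.elim (1 : H →L[ℂ] H) 0, map_zero]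
    have := subsingleton_of_zero_eq_one h10.symm
    exact ⟨fun _ _ _ => (Subsingleton.elim _ _).le, fun _ _ _ => (Subsingleton.elim _ _).le,
      fun _ _ _ => (Subsingleton.elim _ _).le⟩
  have hm' : m ≤ 1 := by
    refine (le_algebraMap_iff_spectrum_le (R := ℝ) (r := 1)
      (a := algebraMap ℝ (H →L[ℂ] H) m) (IsSelfAdjoint.algebraMap _ (.all m))).1 ?_ m ?_
    · simpa [Algebra.algebraMap_eq_smul_one] using hm1
    · simp [spectrum.scalar_eq]
  have hsM : ∀ t ∈ spectrum ℝ A, ∀ s ∈ Set.Icc 1 t, s ≤ M := fun t ht s hs =>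
    hs.2.trans (le_of_mem_spectrum_of_le_smul_one h1A hAM ht)
  refine ⟨fun p hp0 hp1 => ?_, fun p _ hp0 => ?_, fun p hp1 _ => ?_⟩
  · rw [mul_sub]
    refine Φ.rpow_map_le hΦ h1A (fun s hs => ?_) (fun t ht s hs => ?_)
    · exact mul_le_mul_of_nonneg_left
        (Real.rpow_le_rpow_of_nonpos hm (hm'.trans hs) (by linarith)) hp0
    · exact mul_le_mul_of_nonneg_left (Real.rpow_le_rpow_of_nonpos
        (zero_lt_one.trans_le hs.1) (hsM t ht s hs) (by linarith)) hp0
  · have key := Φ.map_rpow_le hΦ h1A (p := p) (c := p * m ^ (p - 1)) (d := p * M ^ (p - 1))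
      (fun s hs => mul_le_mul_of_nonpos_left
        (Real.rpow_le_rpow_of_nonpos hm (hm'.trans hs) (by linarith)) hp0)
      (fun t ht s hs => mul_le_mul_of_nonpos_left (Real.rpow_le_rpow_of_nonpos
        (zero_lt_one.trans_le hs.1) (hsM t ht s hs) (by linarith)) hp0)
    calc Φ (A ^ p) + (p * (m ^ (p - 1) - M ^ (p - 1))) • (Φ A - 1)
        ≤ (Φ A ^ p + (p * M ^ (p - 1) - p * m ^ (p - 1)) • (Φ A - 1))
          + (p * (m ^ (p - 1) - M ^ (p - 1))) • (Φ A - 1) := by gcongr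
      _ = Φ A ^ p := by module
  · rw [mul_sub]
    refine Φ.map_rpow_le hΦ h1A (fun s hs => ?_) (fun t ht s hs => ?_)
    · exact mul_le_mul_of_nonneg_left
        (Real.rpow_le_rpow hm.le (hm'.trans hs) (by linarith)) (by linarith)
    · exact mul_le_mul_of_nonneg_left (Real.rpow_le_rpow
        (zero_le_one.trans hs.1) (hsM t ht s hs) (by linarith)) (by linarith)
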